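/- Let $d\ge 1$, let $\mathbb{B}^d=\{z\in\mathbb{C}^d:|z|<1\}$ be the open unit ball, write $w\cdot\bar z=\sum_{j=1}^d w_j\bar z_j$, and let $\tau$ be the hyperbolic volume measure $d\tau(z)=(1-|z|^2)^{-(d+1)}\,dz$ on $\mathbb{B}^d$, where $dz$ is $2d$-dimensional Lebesgue measure. Fix a real number $\lambda>d/2$ and let $c_\lambda=\Gamma(\lambda)/(\pi^d\,\Gamma(\lambda-d))$, interpreted as $0$ if $\lambda$ is an integer and $\lambda\le d$. Then for every $\varphi\in L^2(\mathbb{B}^d,\tau)$ and every $z\in\mathbb{B}^d$ the integral $$A_\lambda\varphi(z)=c_\lambda^2\int_{\mathbb{B}^d}\left[\frac{(1-|z|^2)(1-|w|^2)}{(1-w\cdot\bar z)(1-\bar w\cdot z)}\right]^{\lambda}\varphi(w)\,d\tau(w)$$ converges absolutely, and $A_\lambda$ is a bounded linear operator from $L^2(\mathbb{B}^d,\tau)$ to itself. -/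

import Mathlib

open MeasureTheory

noncomputable section

namespace BallToeplitz

/-- Complex `d`-space with its standard Hermitian norm `|z|² = ∑ |z j|²`. -/
abbrev Cn (d : ℕ) : Type := EuclideanSpace ℂ (Fin d)

/-- The open unit ball in complex `d`-space. -/
def unitBall (d : ℕ) : Set (Cn d) := Metric.ball 0 1

/-- `2d`-dimensional (un-normalized) Lebesgue measure on complex `d`-space: the image of the product
of the Lebesgue measures of the `d` coordinate planes. -/
def lebesgue (d : ℕ) : Measure (Cn d) :=
  (volume : Measure (Fin d → ℂ)).map (WithLp.toLp 2)

/-- The hyperbolic volume measure `dτ(z) = (1 - |z|²) ^ (-(d + 1)) dz` of the unit ball, as a measure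
on the ambient space which is concentrated on the ball. -/
def tau (d : ℕ) : Measure (Cn d) :=
  ((lebesgue d).restrict (unitBall d)).withDensity
    (fun z => ENNReal.ofReal (((1 - ‖z‖ ^ 2) ^ (d + 1))⁻¹))

/-- The constant `c_λ = Γ(λ) / (π ^ d Γ(λ - d))`. Mathlib's values `Γ(-n) = 0` and `x / 0 = 0` make it
zero when `λ - d` is a pole of `Γ`; see `cLam_eq_zero`. -/
def cLam (d : ℕ) (lam : ℝ) : ℝ :=
  Real.Gamma lam / (Real.pi ^ d * Real.Gamma (lam - d))

/-- The constant `c_λ` vanishes if `λ` is an integer and `λ ≤ d`. -/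
theorem cLam_eq_zero (d : ℕ) (n : ℤ) (hn : n ≤ d) : cLam d (n : ℝ) = 0 := by
  obtain ⟨m, hm⟩ := Int.eq_ofNat_of_zero_le (sub_nonneg.mpr hn)
  have h : (n : ℝ) - d = -(m : ℝ) := by
    have h2 : ((d : ℤ) : ℝ) - (n : ℝ) = ((m : ℤ) : ℝ) := by exact_mod_cast hm
    push_cast at h2
    linarith
  simp [cLam, h, Real.Gamma_neg_nat_eq_zero]

/-- The pairing `w · z̄ = ∑ j, w j * conj (z j)`. -/
def dotConj {d : ℕ} (w z : Cn d) : ℂ := ∑ j, w j * (starRingEnd ℂ) (z j)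

/-- The kernel `[(1 - |z|²)(1 - |w|²) / ((1 - w · z̄)(1 - w̄ · z))] ^ λ`. The denominator is the real
number `|1 - w · z̄|²`; see `denominator_eq`. -/
def kernel {d : ℕ} (lam : ℝ) (z w : Cn d) : ℝ :=
  ((1 - ‖z‖ ^ 2) * (1 - ‖w‖ ^ 2) / ‖1 - dotConj w z‖ ^ 2) ^ lam

theorem denominator_eq {d : ℕ} (z w : Cn d) :
    (1 - dotConj w z) * (1 - dotConj z w) = ((‖1 - dotConj w z‖ ^ 2 : ℝ) : ℂ) := by
  have h : 1 - dotConj z w = (starRingEnd ℂ) (1 - dotConj w z) := by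
    simp [dotConj, mul_comm]
  rw [h, Complex.mul_conj, Complex.normSq_eq_norm_sq]

/-- The function `A_λ φ (z) = c_λ² ∫ kernel λ z w · φ(w) dτ(w)`. -/
def integralOp {d : ℕ} (lam : ℝ) (φ : Cn d → ℂ) (z : Cn d) : ℂ :=
  ((cLam d lam ^ 2 : ℝ) : ℂ) * ∫ w, (kernel lam z w : ℂ) * φ w ∂(tau d)

end BallToeplitz

end

namespace BallToeplitz

open Set ENNReal

/-! The operator is bounded by the Schur test with test function `(1 - |w|²) ^ (d / 2)`. Put `e = λ
- d / 2 > 0`. Against `τ`, the kernel times the test function is `(1 - |z|²) ^ λ` times `(1 - |w|²)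
^ (e - 1) / |1 - w · z̄| ^ (d + 2e)`. The Forelli–Rudin estimate `exists_lintegral_ball_le` bounds
the Lebesgue integral of the latter by a multiple of `(1 - |z|²) ^ (-e)`, and `λ - e = d / 2`
returns the test function.

For Forelli–Rudin, a unitary map moves `z` to the first axis, so the denominator involves one
coordinate only. Integrating out the others (`exists_lintegral_posPow_sub_normSq_le`) leaves the
disc estimate `exists_lintegral_disc_le`, where lower bounds for `|1 - r w|` separate radius from
angle.

Absolute convergence at every `z` is Cauchy–Schwarz, since `memLp_kernel` puts each kernel section
in `L²(τ)`. The constant `c_λ` is only a scalar factor. -/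

/-- The truncated power `a₊ ^ s` with values in `[0, ∞]`; it vanishes for `a ≤ 0`. -/
noncomputable def posPow (s a : ℝ) : ℝ≥0∞ := if 0 < a then ENNReal.ofReal (a ^ s) else 0

theorem posPow_of_pos {s a : ℝ} (ha : 0 < a) : posPow s a = ENNReal.ofReal (a ^ s) := if_pos ha

theorem posPow_of_nonpos {s a : ℝ} (ha : a ≤ 0) : posPow s a = 0 := if_neg ha.not_gt

@[fun_prop]
theorem measurable_posPow (s : ℝ) : Measurable (posPow s) :=
  Measurable.ite measurableSet_Ioi (by fun_prop) measurable_const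

theorem posPow_eq_indicator (s : ℝ) :
    posPow s = (Ioi 0).indicator fun a => ENNReal.ofReal (a ^ s) := by
  ext a
  simp [posPow, indicator_apply]

/-! ### One-variable integrals of powers -/

theorem lintegral_Ioc_rpow {b c : ℝ} (hb : -1 < b) (hc : 0 ≤ c) :
    ∫⁻ x in Ioc 0 c, ENNReal.ofReal (x ^ b) = ENNReal.ofReal (c ^ (b + 1) / (b + 1)) := by
  have hint := intervalIntegral.intervalIntegrable_rpow' (a := 0) (b := c) hb
  rw [intervalIntegrable_iff_integrableOn_Ioc_of_le hc] at hint
  rw [← ofReal_integral_eq_lintegral_ofReal hint, ← intervalIntegral.integral_of_le hc,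
    integral_rpow (Or.inl hb), Real.zero_rpow (by linarith), sub_zero]
  exact (ae_restrict_iff' measurableSet_Ioc).2 (.of_forall fun x hx => Real.rpow_nonneg hx.1.le _)

theorem lintegral_Ioi_rpow {e c : ℝ} (he : 0 < e) (hc : 0 < c) :
    ∫⁻ x in Ioi c, ENNReal.ofReal (x ^ (-1 - e)) = ENNReal.ofReal (c ^ (-e) / e) := by
  rw [← ofReal_integral_eq_lintegral_ofReal (integrableOn_Ioi_rpow_of_lt (by linarith) hc),
    integral_Ioi_rpow_of_lt (by linarith) hc]
  · congr 1
    rw [show -1 - e + 1 = -e by ring, neg_div_neg_eq]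
  · exact (ae_restrict_iff' measurableSet_Ioi).2
      (.of_forall fun x hx => Real.rpow_nonneg (hc.trans hx).le _)

/-- The truncated powers convolve, on the half line, to truncated powers. -/
theorem lintegral_posPow_sub {b : ℝ} (hb : -1 < b) (a : ℝ) :
    ∫⁻ t in Ioi 0, posPow b (a - t) = ENNReal.ofReal (b + 1)⁻¹ * posPow (b + 1) a := by
  rcases le_or_gt a 0 with ha | ha
  · rw [posPow_of_nonpos ha, mul_zero]
    refine (setLIntegral_congr_fun measurableSet_Ioi fun t (ht : 0 < t) =>
      posPow_of_nonpos (by linarith)).trans (by simp)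
  · rw [← lintegral_indicator measurableSet_Ioi]
    have h1 : ∀ t, (Ioi (0 : ℝ)).indicator (fun t => posPow b (a - t)) t
        = (fun x => (Iio a).indicator (posPow b) x) (a - t) := by
      intro t
      simp [indicator_apply]
    simp_rw [h1]
    rw [lintegral_sub_left_eq_self (fun x => (Iio a).indicator (posPow b) x) a,
      posPow_eq_indicator, posPow_of_pos ha, indicator_indicator,
      lintegral_indicator (measurableSet_Iio.inter measurableSet_Ioi), inter_comm, Ioi_inter_Iio,
      setLIntegral_congr Ioo_ae_eq_Ioc, lintegral_Ioc_rpow hb ha.le, ← ENNReal.ofReal_mul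
      (by rw [inv_nonneg]; linarith)]
    congr 1
    ring

/-- Cut at `x = δ`: below, replace `δ + x` by `δ`; above, replace it by `x`. Both pieces scale as `δ
^ (-e)`. -/
theorem lintegral_posPow_mul_add_rpow_le {b e δ : ℝ} (hb : -1 < b) (he : 0 < e) (hδ : 0 < δ) :
    ∫⁻ x, posPow b x * ENNReal.ofReal ((δ + x) ^ (-(b + 1 + e)))
      ≤ ENNReal.ofReal (((b + 1)⁻¹ + e⁻¹) * δ ^ (-e)) := by
  have key : ∀ x, posPow b x * ENNReal.ofReal ((δ + x) ^ (-(b + 1 + e)))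
      ≤ (Ioc 0 δ).indicator
          (fun x => ENNReal.ofReal (δ ^ (-(b + 1 + e))) * ENNReal.ofReal (x ^ b)) x
        + (Ioi δ).indicator (fun x => ENNReal.ofReal (x ^ (-1 - e))) x := by
    intro x
    rcases le_or_gt x 0 with hx | hx
    · simp [posPow_of_nonpos hx]
    rw [posPow_of_pos hx]
    rcases le_or_gt x δ with h | h
    · rw [indicator_of_mem (show x ∈ Ioc 0 δ from ⟨hx, h⟩),
        indicator_of_notMem (show x ∉ Ioi δ from h.not_gt), add_zero, mul_comm]
      gcongr ?_ * _
      exact ENNReal.ofReal_le_ofReal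
        (Real.rpow_le_rpow_of_nonpos hδ (by linarith) (by linarith))
    · rw [indicator_of_mem (show x ∈ Ioi δ from h),
        indicator_of_notMem (show x ∉ Ioc 0 δ from fun hh => hh.2.not_gt h), zero_add,
        ← ENNReal.ofReal_mul (Real.rpow_nonneg hx.le _)]
      refine ENNReal.ofReal_le_ofReal ?_
      rw [show -1 - e = b + -(b + 1 + e) by ring, Real.rpow_add hx]
      gcongr ?_ * ?_
      exact Real.rpow_le_rpow_of_nonpos hx (by linarith) (by linarith)
  refine (lintegral_mono key).trans ?_
  rw [lintegral_add_left (by measurability), lintegral_indicator measurableSet_Ioc,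
    lintegral_indicator measurableSet_Ioi, lintegral_const_mul _ (by fun_prop),
    lintegral_Ioc_rpow hb hδ.le, lintegral_Ioi_rpow he hδ, ← ENNReal.ofReal_mul (by positivity),
    ← ENNReal.ofReal_add]
  · refine le_of_eq ?_
    congr 1
    rw [mul_div_assoc', ← Real.rpow_add hδ, show -(b + 1 + e) + (b + 1) = -e by ring]
    ring
  · have : 0 < b + 1 := by linarith
    positivity
  · positivity

/-! ### Polar coordinates in the plane -/

/-- Polar coordinates for functions which split into a radial and an angular part. -/
theorem lintegral_normSq_mul_arg {g h : ℝ → ℝ≥0∞} (hg : Measurable g) (hh : Measurable h) :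
    ∫⁻ w : ℂ, g (‖w‖ ^ 2) * h w.arg
      = 2⁻¹ * (∫⁻ t in Ioi 0, g t) * ∫⁻ θ in Ioo (-Real.pi) Real.pi, h θ := by
  have h1 : ∫⁻ t in Ioi 0, g t = 2 * ∫⁻ r in Ioi (0 : ℝ), ENNReal.ofReal r * g (r ^ 2) := by
    have himg : (fun r : ℝ => r ^ 2) '' Ioi 0 = Ioi 0 := by
      ext t
      constructor
      · rintro ⟨r, hr, rfl⟩
        exact pow_pos (mem_Ioi.1 hr) 2
      · intro ht
        exact ⟨√t, Real.sqrt_pos.2 ht, Real.sq_sqrt (le_of_lt ht)⟩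
    have := lintegral_image_eq_lintegral_abs_deriv_mul (s := Ioi (0 : ℝ)) (f := fun r => r ^ 2)
      (f' := fun r => 2 * r) measurableSet_Ioi
      (fun x _ => by simpa using (hasDerivAt_pow 2 x).hasDerivWithinAt)
      (fun x hx y hy hxy => by
        simpa using (sq_eq_sq₀ (le_of_lt hx) (le_of_lt hy)).1 hxy) g
    rw [himg] at this
    rw [this, ← lintegral_const_mul _ (by fun_prop)]
    refine setLIntegral_congr_fun measurableSet_Ioi fun r (hr : 0 < r) => ?_
    rw [abs_of_pos (by positivity), ENNReal.ofReal_mul zero_le_two, mul_assoc]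
    simp
  rw [h1, ← mul_assoc, ENNReal.inv_mul_cancel two_ne_zero ofNat_ne_top, one_mul,
    ← Complex.lintegral_comp_polarCoord_symm]
  have h2 : ∀ p ∈ polarCoord.target,
      ENNReal.ofReal p.1 • (g (‖Complex.polarCoord.symm p‖ ^ 2)
        * h (Complex.polarCoord.symm p).arg)
      = (ENNReal.ofReal p.1 * g (p.1 ^ 2)) * h p.2 := by
    rintro ⟨r, θ⟩ ⟨hr, hθ⟩
    have hr' : 0 < r := hr
    rw [Complex.norm_polarCoord_symm, abs_of_pos hr', Complex.polarCoord_symm_apply,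
      Complex.ofReal_cos, Complex.ofReal_sin, Complex.arg_mul_cos_add_sin_mul_I hr' ⟨hθ.1, hθ.2.le⟩, smul_eq_mul, mul_assoc]
  rw [setLIntegral_congr_fun polarCoord.open_target.measurableSet h2, polarCoord_target,
    Measure.volume_eq_prod, ← Measure.prod_restrict,
    lintegral_prod_mul (f := fun r => ENNReal.ofReal r * g (r ^ 2)) (by fun_prop) (by fun_prop)]

theorem lintegral_normSq {g : ℝ → ℝ≥0∞} (hg : Measurable g) :
    ∫⁻ w : ℂ, g (‖w‖ ^ 2) = ENNReal.ofReal Real.pi * ∫⁻ t in Ioi 0, g t := by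
  have h := lintegral_normSq_mul_arg hg (h := fun _ => 1) measurable_const
  simp only [mul_one, lintegral_const, one_mul, Measure.restrict_apply MeasurableSet.univ,
    univ_inter, Real.volume_Ioo, sub_neg_eq_add] at h
  rw [h, ← two_mul, ENNReal.ofReal_mul zero_le_two, mul_comm, ← mul_assoc]
  congr 1
  rw [mul_comm (ENNReal.ofReal 2), mul_assoc, ENNReal.ofReal_ofNat,
    ENNReal.mul_inv_cancel two_ne_zero ofNat_ne_top, mul_one]

/-! ### The Forelli–Rudin estimate in the disc -/

/-- With `s = |ζ|` and `u = |arg ζ| / π ≤ 1`, Jordan's inequality gives `|1 - ζ|² ≥ (1 - s)² + 4 s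
u² ≥ u² (1 + s)² ≥ u²`. -/
theorem abs_arg_div_pi_le_norm_one_sub (ζ : ℂ) :
    |ζ.arg| / Real.pi ≤ ‖1 - ζ‖ := by
  set s := ‖ζ‖
  set θ := ζ.arg
  have hs : 0 ≤ s := norm_nonneg ζ
  have hθ : |θ| ≤ Real.pi := Complex.abs_arg_le_pi ζ
  have hpi := Real.pi_pos
  have hsq : ‖1 - ζ‖ ^ 2 = (1 - s) ^ 2 + 4 * s * Real.sin (θ / 2) ^ 2 := by
    have hre : ζ.re = s * Real.cos θ := (Complex.norm_mul_cos_arg ζ).symm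
    have him : ζ.im = s * Real.sin θ := (Complex.norm_mul_sin_arg ζ).symm
    have hc : Real.cos θ = 1 - 2 * Real.sin (θ / 2) ^ 2 := by
      have := Real.cos_two_mul' (θ / 2)
      rw [mul_div_cancel₀ _ two_ne_zero] at this
      nlinarith [Real.sin_sq_add_cos_sq (θ / 2)]
    rw [← Complex.normSq_eq_norm_sq, Complex.normSq_apply]
    simp only [Complex.sub_re, Complex.sub_im, Complex.one_re, Complex.one_im, hre, him]
    linear_combination s ^ 2 * Real.sin_sq_add_cos_sq θ - 2 * s * hc
  have hu : |θ| / Real.pi ≤ |Real.sin (θ / 2)| := by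
    have := Real.mul_abs_le_abs_sin (x := θ / 2) (by rw [abs_div, abs_two]; linarith)
    refine le_trans (le_of_eq ?_) this
    rw [abs_div, abs_two]
    field_simp
  have hu0 : 0 ≤ |θ| / Real.pi := by positivity
  have hu1 : |θ| / Real.pi ≤ 1 := (div_le_one hpi).2 hθ
  refine le_of_sq_le_sq ?_ (norm_nonneg _)
  rw [hsq, ← sq_abs (Real.sin (θ / 2))]
  set u := |θ| / Real.pi
  have h1 : u ^ 2 ≤ |Real.sin (θ / 2)| ^ 2 := by gcongr
  have h2 : u ^ 2 ≤ 1 := by nlinarith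
  nlinarith [mul_nonneg hs (sub_nonneg.2 h1), mul_nonneg (sq_nonneg (1 - s)) (sub_nonneg.2 h2),
    mul_nonneg hs (sq_nonneg u), mul_nonneg (mul_nonneg hs hs) (sq_nonneg u)]

theorem lintegral_add_abs_rpow_le {e δ : ℝ} (he : 0 < e) (hδ : 0 < δ) :
    ∫⁻ θ, ENNReal.ofReal ((δ + |θ|) ^ (-(1 + e)))
      ≤ ENNReal.ofReal (2 * (1 + e⁻¹) * δ ^ (-e)) := by
  have h := lintegral_posPow_mul_add_rpow_le (b := 0) (by norm_num) he hδ
  simp only [zero_add, inv_one] at h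
  let F : ℝ → ℝ≥0∞ := fun x => posPow 0 x * ENNReal.ofReal ((δ + x) ^ (-(1 + e)))
  have hF : Measurable F := by fun_prop
  -- Equality fails at `θ = 0`, where both truncated powers vanish.
  have hae : (fun θ : ℝ => ENNReal.ofReal ((δ + |θ|) ^ (-(1 + e))))
      =ᵐ[volume] fun θ => F θ + F (-θ) := by
    filter_upwards [Measure.ae_ne volume (0 : ℝ)] with θ hθ
    rcases lt_or_gt_of_ne hθ with h0 | h0
    · simp [F, posPow_of_nonpos h0.le, posPow_of_pos (neg_pos.2 h0), abs_of_neg h0]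
    · simp [F, posPow_of_pos h0, posPow_of_nonpos (neg_nonpos.2 h0.le), abs_of_pos h0]
  rw [lintegral_congr_ae hae, lintegral_add_left hF, lintegral_neg_eq_self F, ← two_mul, mul_assoc,
    ENNReal.ofReal_mul zero_le_two, ENNReal.ofReal_ofNat]
  gcongr

theorem add_div_four_le_norm_one_sub {r : ℝ} (hr0 : 0 ≤ r) (hr1 : r < 1) {w : ℂ} (hw : ‖w‖ < 1) :
    ((1 - r ^ 2) + (1 - ‖w‖ ^ 2)) / 4 ≤ ‖1 - (r : ℂ) * w‖ := by
  have h1 : 1 - r * ‖w‖ ≤ ‖1 - (r : ℂ) * w‖ := by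
    have := norm_sub_norm_le (1 : ℂ) ((r : ℂ) * w)
    rwa [norm_one, norm_mul, Complex.norm_real, Real.norm_of_nonneg hr0] at this
  nlinarith [norm_nonneg w, sq_nonneg (r - ‖w‖), sq_nonneg (r + ‖w‖)]

theorem add_abs_arg_div_eight_le_norm_one_sub {r : ℝ} (hr0 : 0 ≤ r) (hr1 : r < 1) {w : ℂ}
    (hw : ‖w‖ < 1) : ((1 - r ^ 2) + |w.arg|) / 8 ≤ ‖1 - (r : ℂ) * w‖ := by
  have h1 := add_div_four_le_norm_one_sub hr0 hr1 hw
  have h2 : |w.arg| / Real.pi ≤ ‖1 - (r : ℂ) * w‖ := by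
    -- For `r = 0` the argument of `r w` is no longer that of `w`, but the right side is `1`.
    rcases hr0.eq_or_lt with rfl | h
    · simpa using (div_le_one Real.pi_pos).2 (Complex.abs_arg_le_pi w)
    · simpa [Complex.arg_real_mul _ h] using abs_arg_div_pi_le_norm_one_sub ((r : ℂ) * w)
  have h3 : |w.arg| / 4 ≤ |w.arg| / Real.pi :=
    div_le_div_of_nonneg_left (abs_nonneg _) Real.pi_pos Real.pi_le_four
  nlinarith [norm_nonneg w]

/-- The Forelli–Rudin estimate in the unit disc. -/
theorem exists_lintegral_disc_le {b e : ℝ} (hb : -1 < b) (he : 0 < e) :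
    ∃ C : ℝ, 0 ≤ C ∧ ∀ r : ℝ, 0 ≤ r → r < 1 →
      ∫⁻ w : ℂ, posPow b (1 - ‖w‖ ^ 2)
          * ENNReal.ofReal (‖1 - (r : ℂ) * w‖ ^ (-(b + 2 + 2 * e)))
        ≤ ENNReal.ofReal (C * (1 - r ^ 2) ^ (-(2 * e))) := by
  have hb' : 0 < b + 1 := by linarith
  -- The exponent splits as `(b + 1 + e) + (1 + e)`: the radial bound (loss `4`) takes the first
  -- part, the angular bound (loss `8`) the second. Each integral contributes `δ ^ (-e)`.
  refine ⟨2⁻¹ * (4 ^ (b + 1 + e) * ((b + 1)⁻¹ + e⁻¹)) * (8 ^ (1 + e) * (2 * (1 + e⁻¹))),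
    by positivity, fun r hr0 hr1 => ?_⟩
  set δ := 1 - r ^ 2 with hδ_def
  have hδ : 0 < δ := by nlinarith
  let g : ℝ → ℝ≥0∞ := fun t =>
    posPow b (1 - t) * ENNReal.ofReal ((δ + (1 - t)) ^ (-(b + 1 + e)))
  let h : ℝ → ℝ≥0∞ := fun θ => ENNReal.ofReal ((δ + |θ|) ^ (-(1 + e)))
  have hg : Measurable g := by fun_prop
  have hh : Measurable h := by fun_prop
  have hgI : ∫⁻ t in Ioi 0, g t ≤ ENNReal.ofReal (((b + 1)⁻¹ + e⁻¹) * δ ^ (-e)) := by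
    refine (setLIntegral_le_lintegral _ _).trans ?_
    rw [lintegral_sub_left_eq_self
      (fun x => posPow b x * ENNReal.ofReal ((δ + x) ^ (-(b + 1 + e)))) 1]
    exact lintegral_posPow_mul_add_rpow_le hb he hδ
  have hhI : ∫⁻ θ in Ioo (-Real.pi) Real.pi, h θ ≤ ENNReal.ofReal (2 * (1 + e⁻¹) * δ ^ (-e)) :=
    (setLIntegral_le_lintegral _ _).trans (lintegral_add_abs_rpow_le he hδ)
  have key : ∀ w : ℂ, posPow b (1 - ‖w‖ ^ 2)
      * ENNReal.ofReal (‖1 - (r : ℂ) * w‖ ^ (-(b + 2 + 2 * e)))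
      ≤ ENNReal.ofReal (4 ^ (b + 1 + e) * 8 ^ (1 + e)) * (g (‖w‖ ^ 2) * h w.arg) := by
    intro w
    rcases le_or_gt (1 - ‖w‖ ^ 2) 0 with hw | hw
    · simp [posPow_of_nonpos hw]
    have hw1 : ‖w‖ < 1 := by nlinarith [norm_nonneg w]
    have h1 := add_div_four_le_norm_one_sub hr0 hr1 hw1
    have h2 := add_abs_arg_div_eight_le_norm_one_sub hr0 hr1 hw1
    rw [← hδ_def] at h1 h2
    have hx : 0 < δ + (1 - ‖w‖ ^ 2) := by linarith
    have ht : 0 < δ + |w.arg| := by positivity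
    have hN : 0 < ‖1 - (r : ℂ) * w‖ := by linarith
    have hle : ‖1 - (r : ℂ) * w‖ ^ (-(b + 2 + 2 * e))
        ≤ 4 ^ (b + 1 + e) * 8 ^ (1 + e)
          * ((δ + (1 - ‖w‖ ^ 2)) ^ (-(b + 1 + e)) * (δ + |w.arg|) ^ (-(1 + e))) := by
      rw [show -(b + 2 + 2 * e) = -(b + 1 + e) + -(1 + e) by ring, Real.rpow_add hN]
      calc _ ≤ ((δ + (1 - ‖w‖ ^ 2)) / 4) ^ (-(b + 1 + e))
            * ((δ + |w.arg|) / 8) ^ (-(1 + e)) := by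
            gcongr ?_ * ?_
            · exact Real.rpow_le_rpow_of_nonpos (by positivity) h1 (by linarith)
            · exact Real.rpow_le_rpow_of_nonpos (by positivity) h2 (by linarith)
        _ = _ := by
            rw [Real.div_rpow hx.le (by norm_num), Real.div_rpow ht.le (by norm_num),
              Real.rpow_neg (by norm_num : (0 : ℝ) ≤ 4), Real.rpow_neg (by norm_num : (0 : ℝ) ≤ 8)]
            field_simp
    calc _ ≤ posPow b (1 - ‖w‖ ^ 2) * ENNReal.ofReal (4 ^ (b + 1 + e) * 8 ^ (1 + e)
          * ((δ + (1 - ‖w‖ ^ 2)) ^ (-(b + 1 + e)) * (δ + |w.arg|) ^ (-(1 + e)))) := by gcongr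
      _ = _ := by
          rw [ENNReal.ofReal_mul (by positivity), ENNReal.ofReal_mul (Real.rpow_nonneg hx.le _)]
          ring
  refine (lintegral_mono key).trans ?_
  rw [lintegral_const_mul _ (by fun_prop), lintegral_normSq_mul_arg hg hh]
  calc _ ≤ ENNReal.ofReal (4 ^ (b + 1 + e) * 8 ^ (1 + e))
        * (ENNReal.ofReal 2⁻¹ * ENNReal.ofReal (((b + 1)⁻¹ + e⁻¹) * δ ^ (-e))
          * ENNReal.ofReal (2 * (1 + e⁻¹) * δ ^ (-e))) := by
        rw [ENNReal.ofReal_inv_of_pos two_pos, ENNReal.ofReal_ofNat]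
        gcongr
    _ = _ := by
        rw [← ENNReal.ofReal_mul (by positivity), ← ENNReal.ofReal_mul (by positivity),
          ← ENNReal.ofReal_mul (by positivity)]
        congr 1
        rw [show -(2 * e) = -e + -e by ring, Real.rpow_add hδ]
        ring

/-! ### Slicing, unitary invariance, and the estimate in the ball -/

instance isAddHaarMeasure_lebesgue (d : ℕ) : (lebesgue d).IsAddHaarMeasure :=
  (PiLp.continuousLinearEquiv 2 ℂ (fun _ : Fin d => ℂ)).symm.isAddHaarMeasure_map volume

theorem lintegral_lebesgue {d : ℕ} (F : Cn d → ℝ≥0∞) :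
    ∫⁻ v, F v ∂lebesgue d = ∫⁻ x : Fin d → ℂ, F (WithLp.toLp 2 x) :=
  (lintegral_map_equiv F (MeasurableEquiv.toLp 2 (Fin d → ℂ)))

/-- The point of `(n + 1)`-space with the given first coordinate and remaining coordinates. -/
def consPoint {n : ℕ} (w : ℂ) (y : Cn n) : Cn (n + 1) := WithLp.toLp 2 (Fin.cons w y.ofLp)

theorem normSq_consPoint {n : ℕ} (w : ℂ) (y : Cn n) :
    ‖consPoint w y‖ ^ 2 = ‖w‖ ^ 2 + ‖y‖ ^ 2 := by
  simp [consPoint, EuclideanSpace.norm_sq_eq, Fin.sum_univ_succ]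

theorem lintegral_lebesgue_succ {n : ℕ} {F : Cn (n + 1) → ℝ≥0∞} (hF : Measurable F) :
    ∫⁻ v, F v ∂lebesgue (n + 1) = ∫⁻ w : ℂ, ∫⁻ y, F (consPoint w y) ∂lebesgue n := by
  have hmp := (volume_preserving_piFinSuccAbove (fun _ : Fin (n + 1) => ℂ) 0).symm
  rw [lintegral_lebesgue, ← hmp.lintegral_comp (by fun_prop), Measure.volume_eq_prod,
    lintegral_prod _ (by fun_prop)]
  refine lintegral_congr fun w => ?_
  rw [lintegral_lebesgue]
  refine lintegral_congr fun y => ?_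
  congr 2
  exact Fin.insertNth_zero (α := fun _ => ℂ) w y

/-- Peel off one coordinate at a time: in polar coordinates it contributes a half-line convolution,
which raises the exponent by one. Truncation allows every real `a`, as the induction needs for `a -
|w|²`. -/
theorem exists_lintegral_posPow_sub_normSq_le (n : ℕ) {e : ℝ} (he : 0 < e) :
    ∃ C : ℝ, 0 ≤ C ∧ ∀ a : ℝ, ∫⁻ y, posPow (e - 1) (a - ‖y‖ ^ 2) ∂lebesgue n
      ≤ ENNReal.ofReal C * posPow (e + n - 1) a := by
  induction n with
  | zero =>
    refine ⟨1, zero_le_one, fun a => ?_⟩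
    rw [lintegral_lebesgue]
    rw [volume_pi, Measure.pi_of_empty]
    simp [EuclideanSpace.norm_sq_eq]
  | succ n ih =>
    obtain ⟨C, hC, h⟩ := ih
    have hn : 0 < e + n := by positivity
    refine ⟨C * (Real.pi * (e + n)⁻¹), by positivity, fun a => ?_⟩
    rw [lintegral_lebesgue_succ (by fun_prop)]
    calc _ ≤ ∫⁻ w : ℂ, ENNReal.ofReal C * posPow (e + n - 1) (a - ‖w‖ ^ 2) := by
          refine lintegral_mono fun w => ?_
          simp_rw [normSq_consPoint, ← sub_sub]
          exact h _
      _ = _ := by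
          rw [lintegral_const_mul _ (by fun_prop),
            lintegral_normSq (g := fun t => posPow (e + n - 1) (a - t)) (by fun_prop),
            lintegral_posPow_sub (by linarith), ENNReal.ofReal_mul hC,
            ENNReal.ofReal_mul Real.pi_nonneg]
          push_cast
          rw [show e + n - 1 + 1 = e + (n : ℝ) by ring, show e + (n + 1) - 1 = e + (n : ℝ) by ring]
          ring

/-- Haar measure is unique up to a scalar, and the scalar is `1` because the unit ball is preserved
and has positive finite measure. -/
theorem lebesgue_map_linearIsometryEquiv {d : ℕ} (U : Cn d ≃ₗᵢ[ℂ] Cn d) :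
    (lebesgue d).map U = lebesgue d := by
  have : ((lebesgue d).map U).IsAddHaarMeasure :=
    U.toContinuousLinearEquiv.isAddHaarMeasure_map (lebesgue d)
  have h := Measure.isAddLeftInvariant_eq_smul ((lebesgue d).map U) (lebesgue d)
  set c := ((lebesgue d).map U).addHaarScalarFactor (lebesgue d)
  have hball : (lebesgue d).map U (Metric.ball 0 1) = lebesgue d (Metric.ball 0 1) := by
    rw [Measure.map_apply U.continuous.measurable Metric.isOpen_ball.measurableSet,
      LinearIsometryEquiv.preimage_ball, map_zero]
  have h0 : lebesgue d (Metric.ball 0 1) ≠ 0 := (Metric.measure_ball_pos _ _ one_pos).ne'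
  have hc : (c : ℝ≥0∞) = 1 := by
    rw [h, Measure.smul_apply] at hball
    refine (ENNReal.mul_left_inj h0 measure_ball_lt_top.ne).1 ?_
    rw [one_mul]
    exact hball
  rw [h, ENNReal.coe_eq_one.1 hc, one_smul]

/-- For `z ≠ 0`, complete `z / |z|` to an orthonormal basis with this vector at index `0`, and take
coordinates. -/
theorem exists_linearIsometryEquiv_apply_eq {n : ℕ} (z : Cn (n + 1)) :
    ∃ U : Cn (n + 1) ≃ₗᵢ[ℂ] Cn (n + 1), U z = EuclideanSpace.single 0 (‖z‖ : ℂ) := by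
  by_cases hz : z = 0
  · exact ⟨LinearIsometryEquiv.refl ℂ _, by ext i; simp [hz]⟩
  have hz' : (‖z‖ : ℂ) ≠ 0 := by simpa using hz
  have horth : Orthonormal ℂ (({0} : Set (Fin (n + 1))).domRestrict
      fun _ => ((‖z‖ : ℂ)⁻¹ • z)) := by
    constructor
    · rintro -
      simp [norm_smul, hz]
    · rintro ⟨i, hi⟩ ⟨j, hj⟩ hij
      exact absurd (Subtype.ext (hi.trans hj.symm)) hij
  obtain ⟨b, hb⟩ := horth.exists_orthonormalBasis_extension_of_card_eq (by simp)
  refine ⟨b.repr, ?_⟩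
  have h : z = (‖z‖ : ℂ) • b 0 := by
    rw [hb 0 rfl, smul_smul, mul_inv_cancel₀ hz', one_smul]
  conv_lhs => rw [h, map_smul, b.repr_self]
  ext i
  simp

theorem dotConj_eq_inner {d : ℕ} (w z : Cn d) : dotConj w z = inner ℂ z w := by
  simp [dotConj, PiLp.inner_apply]

/-- The Forelli–Rudin estimate in the unit ball. -/
theorem exists_lintegral_ball_le (n : ℕ) {e : ℝ} (he : 0 < e) :
    ∃ C : ℝ, 0 ≤ C ∧ ∀ z : Cn (n + 1), ‖z‖ < 1 →
      ∫⁻ w, posPow (e - 1) (1 - ‖w‖ ^ 2)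
          * ENNReal.ofReal (‖1 - dotConj w z‖ ^ (-((n + 1 : ℕ) + 2 * e))) ∂lebesgue (n + 1)
        ≤ ENNReal.ofReal (C * (1 - ‖z‖ ^ 2) ^ (-e)) := by
  obtain ⟨C₁, hC₁, h₁⟩ := exists_lintegral_posPow_sub_normSq_le n he
  have hn : (0 : ℝ) ≤ n := n.cast_nonneg
  -- Integrating out `n` coordinates produces `b = e + n - 1`; halving `e` makes the disc exponent
  -- `b + 2 + e = n + 1 + 2e`.
  obtain ⟨C₂, hC₂, h₂⟩ := exists_lintegral_disc_le (b := e + n - 1) (e := e / 2)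
    (by linarith) (by positivity)
  refine ⟨C₁ * C₂, by positivity, fun z hz => ?_⟩
  obtain ⟨U, hU⟩ := exists_linearIsometryEquiv_apply_eq z
  let F : Cn (n + 1) → ℝ≥0∞ := fun v => posPow (e - 1) (1 - ‖v‖ ^ 2)
    * ENNReal.ofReal (‖1 - (‖z‖ : ℂ) * v 0‖ ^ (-((n + 1 : ℕ) + 2 * e)))
  have hF : Measurable F := by fun_prop
  have hrot : ∀ w, posPow (e - 1) (1 - ‖w‖ ^ 2)
      * ENNReal.ofReal (‖1 - dotConj w z‖ ^ (-((n + 1 : ℕ) + 2 * e))) = F (U w) := by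
    intro w
    have : dotConj w z = (‖z‖ : ℂ) * U w 0 := by
      rw [dotConj_eq_inner, ← U.inner_map_map, hU, EuclideanSpace.inner_single_left]
      simp
    simp only [F, this, U.norm_map]
  simp_rw [hrot]
  rw [← lintegral_map hF U.continuous.measurable, lebesgue_map_linearIsometryEquiv,
    lintegral_lebesgue_succ hF]
  calc _ ≤ ∫⁻ w : ℂ, ENNReal.ofReal C₁ * (posPow (e + n - 1) (1 - ‖w‖ ^ 2)
        * ENNReal.ofReal (‖1 - (‖z‖ : ℂ) * w‖ ^ (-(e + n - 1 + 2 + 2 * (e / 2))))) := by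
        refine lintegral_mono fun w => ?_
        have hF' : ∀ y, F (consPoint w y) = posPow (e - 1) (1 - ‖w‖ ^ 2 - ‖y‖ ^ 2)
            * ENNReal.ofReal (‖1 - (‖z‖ : ℂ) * w‖ ^ (-(e + n - 1 + 2 + 2 * (e / 2)))) := by
          intro y
          have h0 : consPoint w y 0 = w := rfl
          simp only [F, normSq_consPoint, h0, sub_sub]
          congr 4
          push_cast
          ring
        simp_rw [hF']
        rw [lintegral_mul_const _ (by fun_prop), ← mul_assoc]
        gcongr
        exact h₁ _
    _ ≤ _ := by
        rw [lintegral_const_mul _ (by fun_prop), mul_assoc, ENNReal.ofReal_mul hC₁]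
        gcongr
        simpa only [mul_div_cancel₀ e (two_ne_zero' ℝ)] using h₂ ‖z‖ (norm_nonneg z) hz

/-! ### The Schur test and integral operators on `L²` -/

section Schur

variable {X : Type*} [MeasurableSpace X] {μ : Measure X}

theorem sq_lintegral_mul_le {f g : X → ℝ≥0∞} (hf : Measurable f) (hg : Measurable g) :
    (∫⁻ x, f x * g x ∂μ) ^ 2 ≤ (∫⁻ x, f x ^ 2 ∂μ) * ∫⁻ x, g x ^ 2 ∂μ := by
  have h := ENNReal.lintegral_mul_le_Lp_mul_Lq μ Real.HolderConjugate.two_two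
    hf.aemeasurable hg.aemeasurable
  simp only [Pi.mul_apply, ENNReal.rpow_two] at h
  calc _ ≤ ((∫⁻ x, f x ^ 2 ∂μ) ^ (1 / 2 : ℝ) * (∫⁻ x, g x ^ 2 ∂μ) ^ (1 / 2 : ℝ)) ^ 2 := by gcongr
    _ = _ := by
        rw [mul_pow, ← ENNReal.rpow_mul_natCast, ← ENNReal.rpow_mul_natCast]
        norm_num

/-- The Schur test for a symmetric nonnegative kernel. -/
theorem lintegral_sq_lintegral_le_of_schur [SFinite μ] {K : X → X → ℝ≥0∞}
    (hK : Measurable (Function.uncurry K)) (hsymm : ∀ x y, K x y = K y x) {h : X → ℝ≥0∞}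
    (hh : Measurable h) (h0 : ∀ᵐ x ∂μ, h x ≠ 0) (htop : ∀ᵐ x ∂μ, h x ≠ ∞) {C : ℝ≥0∞}
    (hC : ∀ᵐ x ∂μ, ∫⁻ y, K x y * h y ∂μ ≤ C * h x) {f : X → ℝ≥0∞} (hf : Measurable f) :
    ∫⁻ x, (∫⁻ y, K x y * f y ∂μ) ^ 2 ∂μ ≤ C ^ 2 * ∫⁻ x, f x ^ 2 ∂μ := by
  have hKx : ∀ x, Measurable (K x) := fun x => hK.comp measurable_prodMk_left
  have h1 : ∀ᵐ x ∂μ, (∫⁻ y, K x y * f y ∂μ) ^ 2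
      ≤ C * ∫⁻ y, h x * (K x y * ((h y)⁻¹ * f y ^ 2)) ∂μ := by
    filter_upwards [hC] with x hx
    have hKx' := hKx x
    -- Cauchy–Schwarz will be applied to this splitting, so that the first factor is controlled by
    -- `hC`.
    have hfac : ∫⁻ y, K x y * f y ∂μ = ∫⁻ y, (K x y * h y) ^ (1 / 2 : ℝ)
        * ((K x y * (h y)⁻¹) ^ (1 / 2 : ℝ) * f y) ∂μ := by
      refine lintegral_congr_ae ?_
      filter_upwards [h0, htop] with y hy0 hytop
      rw [← mul_assoc, ← ENNReal.mul_rpow_of_nonneg _ _ (by norm_num), mul_mul_mul_comm,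
        ENNReal.mul_inv_cancel hy0 hytop, mul_one, ← sq, ← ENNReal.rpow_natCast_mul]
      norm_num
    have hsq : ∀ a : ℝ≥0∞, (a ^ (1 / 2 : ℝ)) ^ 2 = a := fun a => by
      rw [← ENNReal.rpow_mul_natCast]
      norm_num
    rw [hfac]
    refine (sq_lintegral_mul_le (by fun_prop) (by fun_prop)).trans ?_
    simp_rw [mul_pow, hsq]
    rw [lintegral_const_mul _ (by fun_prop), ← mul_assoc]
    simp_rw [mul_assoc (K x _)]
    gcongr
  have hmeas : Measurable
      (Function.uncurry fun x y => h x * (K x y * ((h y)⁻¹ * f y ^ 2))) := by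
    have : Measurable fun p : X × X => K p.1 p.2 := hK
    simp only [Function.uncurry_def]
    fun_prop
  refine (lintegral_mono_ae h1).trans ?_
  -- After Tonelli, symmetry of `K` lets `hC` be used a second time, in the other variable.
  rw [lintegral_const_mul _ hmeas.lintegral_prod_right, lintegral_lintegral_swap hmeas.aemeasurable,
    sq, mul_assoc]
  gcongr
  rw [← lintegral_const_mul _ (by fun_prop)]
  refine lintegral_mono_ae ?_
  filter_upwards [hC, h0, htop] with y hy hy0 hytop
  have hKy := hKx y
  calc _ = (∫⁻ x, K y x * h x ∂μ) * ((h y)⁻¹ * f y ^ 2) := by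
        rw [← lintegral_mul_const _ (by fun_prop)]
        refine lintegral_congr fun x => ?_
        rw [hsymm x y]
        ring
    _ ≤ C * h y * ((h y)⁻¹ * f y ^ 2) := by gcongr
    _ = C * f y ^ 2 * (h y * (h y)⁻¹) := by ring
    _ = _ := by rw [ENNReal.mul_inv_cancel hy0 hytop, mul_one]

theorem eLpNorm_two_sq {E : Type*} [NormedAddCommGroup E] (f : X → E) :
    eLpNorm f 2 μ ^ 2 = ∫⁻ x, ‖f x‖ₑ ^ 2 ∂μ := by
  simpa using eLpNorm_nnreal_pow_eq_lintegral (f := f) (μ := μ) (p := 2) two_ne_zero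

/-- A nonnegative kernel satisfying an `L²` bound defines a bounded operator. -/
theorem exists_continuousLinearMap_of_lintegral_le [SFinite μ] {K : X → X → ℝ}
    (hK : Measurable (Function.uncurry K)) {C : ℝ} (hC0 : 0 ≤ C)
    (hC : ∀ f : X → ℝ≥0∞, Measurable f → ∫⁻ x, (∫⁻ y, ‖K x y‖ₑ * f y ∂μ) ^ 2 ∂μ
      ≤ ENNReal.ofReal C ^ 2 * ∫⁻ x, f x ^ 2 ∂μ)
    (hint : ∀ φ : Lp ℂ 2 μ, ∀ᵐ x ∂μ, Integrable (fun y => (K x y : ℂ) * φ y) μ) :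
    ∃ A : Lp ℂ 2 μ →L[ℂ] Lp ℂ 2 μ, ∀ φ : Lp ℂ 2 μ,
      A φ =ᵐ[μ] fun x => ∫ y, (K x y : ℂ) * φ y ∂μ := by
  have hbound : ∀ φ : Lp ℂ 2 μ, eLpNorm (fun x => ∫ y, (K x y : ℂ) * φ y ∂μ) 2 μ
      ≤ ENNReal.ofReal C * eLpNorm φ 2 μ := by
    intro φ
    refine (ENNReal.pow_le_pow_left_iff two_ne_zero).1 ?_
    rw [mul_pow, eLpNorm_two_sq, eLpNorm_two_sq]
    refine le_trans (lintegral_mono fun x => ?_)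
      (hC (fun y => ‖φ y‖ₑ) (Lp.stronglyMeasurable φ).measurable.enorm)
    gcongr
    refine (enorm_integral_le_lintegral_enorm _).trans (le_of_eq ?_)
    refine lintegral_congr fun y => ?_
    rw [enorm_mul]
    congr 1
    exact enorm_eq_iff_norm_eq.2 (Complex.norm_real _)
  have hmem : ∀ φ : Lp ℂ 2 μ, MemLp (fun x => ∫ y, (K x y : ℂ) * φ y ∂μ) 2 μ := by
    intro φ
    refine ⟨?_, (hbound φ).trans_lt (ENNReal.mul_lt_top ofReal_lt_top (Lp.eLpNorm_lt_top φ))⟩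
    refine AEStronglyMeasurable.integral_prod_right' (f := fun p : X × X => (K p.1 p.2 : ℂ) * φ p.2)
      (Measurable.aestronglyMeasurable ?_)
    have h1 : Measurable fun p : X × X => K p.1 p.2 := hK
    have h2 := (Lp.stronglyMeasurable φ).measurable
    fun_prop
  let T : Lp ℂ 2 μ →ₗ[ℂ] Lp ℂ 2 μ :=
    { toFun := fun φ => (hmem φ).toLp
      map_add' := fun φ ψ => by
        rw [← MemLp.toLp_add, MemLp.toLp_eq_toLp_iff]
        -- Only additivity needs integrability; scalars leave the integral unconditionally.
        filter_upwards [hint φ, hint ψ] with x hφ hψ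
        rw [Pi.add_apply, ← integral_add hφ hψ]
        refine integral_congr_ae ?_
        filter_upwards [Lp.coeFn_add φ ψ] with y hy
        rw [hy, Pi.add_apply, mul_add]
      map_smul' := fun c φ => by
        rw [RingHom.id_apply, ← MemLp.toLp_const_smul, MemLp.toLp_eq_toLp_iff]
        refine .of_forall fun x => ?_
        rw [Pi.smul_apply, smul_eq_mul, ← integral_const_mul]
        refine integral_congr_ae ?_
        filter_upwards [Lp.coeFn_smul c φ] with y hy
        rw [hy, Pi.smul_apply, smul_eq_mul]
        ring }
  refine ⟨T.mkContinuous C fun φ => ?_, fun φ => (hmem φ).coeFn_toLp⟩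
  change ‖(hmem φ).toLp‖ ≤ C * ‖φ‖
  rw [Lp.norm_toLp, Lp.norm_def, ← ENNReal.toReal_ofReal hC0, ← ENNReal.toReal_mul]
  exact ENNReal.toReal_mono (ENNReal.mul_lt_top ofReal_lt_top (Lp.eLpNorm_lt_top φ)).ne
    (by simpa only [ENNReal.toReal_ofReal hC0] using hbound φ)

end Schur

/-! ### The kernel and the hyperbolic measure -/

instance sigmaFinite_tau (d : ℕ) : SigmaFinite (tau d) :=
  SigmaFinite.withDensity_ofReal _

theorem one_sub_normSq_pos {d : ℕ} {w : Cn d} (hw : w ∈ unitBall d) : 0 < 1 - ‖w‖ ^ 2 := by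
  have : ‖w‖ < 1 := mem_ball_zero_iff.1 hw
  nlinarith [norm_nonneg w]

theorem ae_mem_unitBall (d : ℕ) : ∀ᵐ w ∂tau d, w ∈ unitBall d :=
  (withDensity_absolutelyContinuous _ _).ae_le (ae_restrict_mem Metric.isOpen_ball.measurableSet)

/-- The truncated power vanishes off the ball, so it absorbs both the density and the restriction.
-/
theorem lintegral_tau {d : ℕ} {f : Cn d → ℝ≥0∞} (hf : Measurable f) :
    ∫⁻ w, f w ∂tau d = ∫⁻ w, posPow (-(d + 1 : ℕ)) (1 - ‖w‖ ^ 2) * f w ∂lebesgue d := by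
  have hball : MeasurableSet (unitBall d) := Metric.isOpen_ball.measurableSet
  rw [tau, lintegral_withDensity_eq_lintegral_mul _ (by fun_prop) hf, ← lintegral_indicator hball]
  refine lintegral_congr fun w => ?_
  by_cases hw : w ∈ unitBall d
  · have h := one_sub_normSq_pos hw
    rw [indicator_of_mem hw, Pi.mul_apply, posPow_of_pos h, Real.rpow_neg h.le, Real.rpow_natCast]
  · have h : 1 ≤ ‖w‖ := by simpa [unitBall] using hw
    rw [indicator_of_notMem hw, posPow_of_nonpos (by nlinarith), zero_mul]

theorem norm_one_sub_dotConj_comm {d : ℕ} (z w : Cn d) :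
    ‖1 - dotConj w z‖ = ‖1 - dotConj z w‖ := by
  rw [← Complex.norm_conj (1 - dotConj z w)]
  simp [dotConj, mul_comm]

theorem kernel_comm {d : ℕ} (lam : ℝ) (z w : Cn d) : kernel lam z w = kernel lam w z := by
  rw [kernel, kernel, norm_one_sub_dotConj_comm z w, mul_comm (1 - ‖z‖ ^ 2)]

theorem one_sub_norm_le_norm_one_sub_dotConj {d : ℕ} {z w : Cn d} (hw : w ∈ unitBall d) :
    1 - ‖z‖ ≤ ‖1 - dotConj w z‖ := by
  have hw' : ‖w‖ < 1 := mem_ball_zero_iff.1 hw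
  have h1 : ‖dotConj w z‖ ≤ ‖z‖ * ‖w‖ := by
    rw [dotConj_eq_inner]
    exact norm_inner_le_norm z w
  have h2 := norm_sub_norm_le (1 : ℂ) (dotConj w z)
  rw [norm_one] at h2
  nlinarith [norm_nonneg z]

theorem norm_one_sub_dotConj_pos {d : ℕ} {z w : Cn d} (hz : z ∈ unitBall d)
    (hw : w ∈ unitBall d) : 0 < ‖1 - dotConj w z‖ := by
  have hz' : ‖z‖ < 1 := mem_ball_zero_iff.1 hz
  linarith [one_sub_norm_le_norm_one_sub_dotConj (z := z) hw]

theorem kernel_nonneg {d : ℕ} (lam : ℝ) {z w : Cn d} (hz : z ∈ unitBall d)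
    (hw : w ∈ unitBall d) : 0 ≤ kernel lam z w := by
  have h1 := one_sub_normSq_pos hz
  have h2 := one_sub_normSq_pos hw
  unfold kernel
  positivity

theorem measurable_kernel (d : ℕ) (lam : ℝ) :
    Measurable (Function.uncurry (kernel (d := d) lam)) := by
  have h : Measurable fun p : Cn d × Cn d => dotConj p.2 p.1 := by
    unfold dotConj
    fun_prop
  unfold kernel
  simp only [Function.uncurry_def]
  fun_prop

theorem measurable_kernel_right {d : ℕ} (lam : ℝ) (z : Cn d) : Measurable (kernel lam z) :=
  (measurable_kernel d lam).of_uncurry_left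

/-- The Schur estimate for the kernel with the test function `(1 - |w|²) ^ (d / 2)`. -/
theorem exists_lintegral_kernel_mul_le {d : ℕ} (hd : 1 ≤ d) {lam : ℝ} (hlam : (d : ℝ) / 2 < lam) :
    ∃ C : ℝ, 0 ≤ C ∧ ∀ z ∈ unitBall d,
      ∫⁻ w, ‖kernel lam z w‖ₑ * posPow (d / 2) (1 - ‖w‖ ^ 2) ∂tau d
        ≤ ENNReal.ofReal C * posPow (d / 2) (1 - ‖z‖ ^ 2) := by
  obtain ⟨n, rfl⟩ : ∃ n, d = n + 1 := ⟨d - 1, by omega⟩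
  set D : ℝ := ((n + 1 : ℕ) : ℝ) with hD
  obtain ⟨C, hC, h⟩ := exists_lintegral_ball_le n (e := lam - D / 2) (by linarith)
  refine ⟨C, hC, fun z hz => ?_⟩
  have hz1 : ‖z‖ < 1 := mem_ball_zero_iff.1 hz
  have hz2 := one_sub_normSq_pos hz
  have hk := measurable_kernel_right lam z
  rw [lintegral_tau (by fun_prop)]
  have key : ∀ w, posPow (-(n + 1 + 1 : ℕ)) (1 - ‖w‖ ^ 2)
        * (‖kernel lam z w‖ₑ * posPow (D / 2) (1 - ‖w‖ ^ 2))
      = ENNReal.ofReal ((1 - ‖z‖ ^ 2) ^ lam) * (posPow (lam - D / 2 - 1) (1 - ‖w‖ ^ 2)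
        * ENNReal.ofReal (‖1 - dotConj w z‖ ^ (-(D + 2 * (lam - D / 2))))) := by
    intro w
    rcases le_or_gt (1 - ‖w‖ ^ 2) 0 with hw | hw
    · simp [posPow_of_nonpos hw]
    have hwb : w ∈ unitBall (n + 1) := by
      rw [unitBall, mem_ball_zero_iff]
      nlinarith [norm_nonneg w]
    have hN := norm_one_sub_dotConj_pos hz hwb
    rw [posPow_of_pos hw, posPow_of_pos hw, posPow_of_pos hw,
      Real.enorm_eq_ofReal (kernel_nonneg lam hz hwb),
      ← ENNReal.ofReal_mul (kernel_nonneg lam hz hwb), ← ENNReal.ofReal_mul (by positivity),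
      ← ENNReal.ofReal_mul (by positivity), ← ENNReal.ofReal_mul (by positivity)]
    congr 1
    rw [kernel, Real.div_rpow (by positivity) (by positivity), Real.mul_rpow hz2.le hw.le,
      -- The powers of `1 - |w|²` come from the density, the kernel and the test function, in this
      -- order.
      show lam - D / 2 - 1 = -(n + 1 + 1 : ℕ) + lam + D / 2 by push_cast [hD]; ring,
      Real.rpow_add hw, Real.rpow_add hw, show -(D + 2 * (lam - D / 2)) = -(2 * lam) by ring,
      Real.rpow_neg hN.le, Real.rpow_mul hN.le, Real.rpow_two]
    ring
  simp_rw [key]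
  have hdot : Measurable fun w : Cn (n + 1) => dotConj w z := by
    unfold dotConj
    fun_prop
  rw [lintegral_const_mul _ (by fun_prop), posPow_of_pos hz2]
  calc _ ≤ ENNReal.ofReal ((1 - ‖z‖ ^ 2) ^ lam)
        * ENNReal.ofReal (C * (1 - ‖z‖ ^ 2) ^ (-(lam - D / 2))) := by
        gcongr
        exact h z hz1
    _ = _ := by
        rw [← ENNReal.ofReal_mul (by positivity), ← ENNReal.ofReal_mul hC, mul_left_comm,
          ← Real.rpow_add hz2]
        congr 3
        ring

/-- For fixed `z`, `|1 - w · z̄| ≥ 1 - |z|` bounds the kernel by `M (1 - |w|²) ^ λ`. Its square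
against `τ` has exponent `2λ - d - 1`, which exceeds `-1` exactly when `λ > d / 2`. -/
theorem memLp_kernel {d : ℕ} {lam : ℝ} (hlam : (d : ℝ) / 2 < lam) {z : Cn d}
    (hz : z ∈ unitBall d) : MemLp (fun w => (kernel lam z w : ℂ)) 2 (tau d) := by
  have hk := measurable_kernel_right lam z
  refine ⟨Measurable.aestronglyMeasurable (by fun_prop), ?_⟩
  obtain ⟨C, hC, h⟩ := exists_lintegral_posPow_sub_normSq_le d (e := 2 * lam - d) (by linarith)
  have hz1 : ‖z‖ < 1 := mem_ball_zero_iff.1 hz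
  have hz2 := one_sub_normSq_pos hz
  have hz3 : 0 < 1 - ‖z‖ := by linarith
  have hd : (0 : ℝ) ≤ d := d.cast_nonneg
  set M := ((1 - ‖z‖ ^ 2) / (1 - ‖z‖) ^ 2) ^ lam with hM
  have key : ∀ w, posPow (-(d + 1 : ℕ)) (1 - ‖w‖ ^ 2) * ‖(kernel lam z w : ℂ)‖ₑ ^ 2
      ≤ ENNReal.ofReal (M ^ 2) * posPow (2 * lam - d - 1) (1 - ‖w‖ ^ 2) := by
    intro w
    rcases le_or_gt (1 - ‖w‖ ^ 2) 0 with hw | hw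
    · simp [posPow_of_nonpos hw]
    have hwb : w ∈ unitBall d := by
      rw [unitBall, mem_ball_zero_iff]
      nlinarith [norm_nonneg w]
    have hN := one_sub_norm_le_norm_one_sub_dotConj (z := z) hwb
    have hkw := kernel_nonneg lam hz hwb
    have hle : kernel lam z w ≤ M * (1 - ‖w‖ ^ 2) ^ lam := by
      rw [hM, ← Real.mul_rpow (by positivity) hw.le, kernel, div_mul_eq_mul_div]
      exact Real.rpow_le_rpow (by positivity) (by gcongr) (by linarith)
    rw [posPow_of_pos hw, posPow_of_pos hw,
      show ‖(kernel lam z w : ℂ)‖ₑ = ENNReal.ofReal (kernel lam z w) by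
        rw [← ofReal_norm, Complex.norm_real, Real.norm_of_nonneg hkw],
      ← ENNReal.ofReal_pow hkw, ← ENNReal.ofReal_mul (by positivity),
      ← ENNReal.ofReal_mul (by positivity)]
    refine ENNReal.ofReal_le_ofReal ?_
    calc _ ≤ (1 - ‖w‖ ^ 2) ^ (-(d + 1 : ℕ) : ℝ) * (M * (1 - ‖w‖ ^ 2) ^ lam) ^ 2 := by gcongr
      _ = _ := by
        rw [show 2 * lam - d - 1 = -(d + 1 : ℕ) + lam + lam by push_cast; ring,
          Real.rpow_add hw, Real.rpow_add hw]
        ring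
  refine (ENNReal.pow_lt_top_iff (n := 2)).1 ?_ |>.resolve_right two_ne_zero
  rw [eLpNorm_two_sq, lintegral_tau (by fun_prop)]
  refine (lintegral_mono key).trans_lt ?_
  rw [lintegral_const_mul _ (by fun_prop)]
  refine ENNReal.mul_lt_top ofReal_lt_top ((h 1).trans_lt ?_)
  rw [posPow_of_pos one_pos]
  exact ENNReal.mul_lt_top ofReal_lt_top ofReal_lt_top

theorem integrable_kernel_mul {d : ℕ} {lam : ℝ} (hlam : (d : ℝ) / 2 < lam) {φ : Cn d → ℂ}
    (hφ : MemLp φ 2 (tau d)) {z : Cn d} (hz : z ∈ unitBall d) :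
    Integrable (fun w => (kernel lam z w : ℂ) * φ w) (tau d) :=
  (memLp_kernel hlam hz).integrable_mul hφ

end BallToeplitz

/-! ### Assembly -/

theorem mainTheorem3 (d : ℕ) (hd : 1 ≤ d) (lam : ℝ) (hlam : (d : ℝ) / 2 < lam) :
    (∀ φ : BallToeplitz.Cn d → ℂ, MemLp φ 2 (BallToeplitz.tau d) →
      ∀ z ∈ BallToeplitz.unitBall d,
        Integrable (fun w => (BallToeplitz.kernel lam z w : ℂ) * φ w) (BallToeplitz.tau d)) ∧
    ∃ A : Lp ℂ 2 (BallToeplitz.tau d) →L[ℂ] Lp ℂ 2 (BallToeplitz.tau d),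
      ∀ φ : Lp ℂ 2 (BallToeplitz.tau d),
        A φ =ᵐ[BallToeplitz.tau d] BallToeplitz.integralOp lam φ := by
  open BallToeplitz in
  refine ⟨fun φ hφ z hz => integrable_kernel_mul hlam hφ hz, ?_⟩
  obtain ⟨C, hC, hschur⟩ := exists_lintegral_kernel_mul_le hd hlam
  have hpos : ∀ᵐ w ∂tau d, 0 < 1 - ‖w‖ ^ 2 :=
    (ae_mem_unitBall d).mono fun w hw => one_sub_normSq_pos hw
  obtain ⟨T, hT⟩ := exists_continuousLinearMap_of_lintegral_le (μ := tau d)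
    (measurable_kernel d lam) hC
    (fun f hf => lintegral_sq_lintegral_le_of_schur
      (h := fun w => posPow (d / 2) (1 - ‖w‖ ^ 2)) (measurable_kernel d lam).enorm
      (fun x y => by rw [kernel_comm]) (by fun_prop)
      (hpos.mono fun w hw => by
        rw [posPow_of_pos hw]
        exact (ENNReal.ofReal_pos.2 (Real.rpow_pos_of_pos hw _)).ne')
      (hpos.mono fun w hw => by
        rw [posPow_of_pos hw]
        exact ENNReal.ofReal_ne_top)
      ((ae_mem_unitBall d).mono hschur) hf)
    (fun φ => (ae_mem_unitBall d).mono fun z hz => integrable_kernel_mul hlam (Lp.memLp φ) hz)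
  -- The bound for `T` holds without the constant, so the case `c_λ = 0` needs no separate
  -- treatment.
  refine ⟨((cLam d lam ^ 2 : ℝ) : ℂ) • T, fun φ => ?_⟩
  filter_upwards [Lp.coeFn_smul ((cLam d lam ^ 2 : ℝ) : ℂ) (T φ), hT φ] with z h1 h2
  rw [smul_apply, h1, Pi.smul_apply, h2, smul_eq_mul, integralOp]
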